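/- A $*$-probability space is a unital complex $*$-algebra $\mathcal A$ with a linear functional $\varphi:\mathcal A\to\mathbb C$ such that $\varphi(1)=1$ and $\varphi(a^*)=\overline{\varphi(a)}$ for all $a\in\mathcal A$ (positivity is not required). For $\chi:\{1,\dots,n\}\to\{l,r\}$ let $\prec_\chi$ be the order on $\{1,\dots,n\}$ in which the elements of $\chi^{-1}(l)$ come first, in increasing order, followed by the elements of $\chi^{-1}(r)$ in decreasing order. Let $BNC(\chi)$ be the set of partitions of $\{1,\dots,n\}$ that are non-crossing for $\prec_\chi$. The bi-free cumulants $\kappa_\chi$ ($n\ge 1$) are determined by $$\varphi(a_1\cdots a_n)=\sum_{\pi\in BNC(\chi)}\prod_{V\in\pi}\kappa_{\chi|_V}\big((a_1,\dots,a_n)|_V\big).$$ A pair $(x,y)$ in $\mathcal A$ is $R$-diagonal if, for all $n\ge1$, all $\chi:\{1,\dots,n\}\to\{l,r\}$ and all $\omega:\{1,\dots,n\}\to\{1,*\}$, with $z_k=x^{\omega(k)}$ if $\chi(k)=l$ and $z_k=y^{\omega(k)}$ if $\chi(k)=r$, one has $\kappa_\chi(z_1,\dots,z_n)=0$ unless $n$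 is even and $\omega$ alternates between $1$ and $*$ along the order $\prec_\chi$. Two pairs $(b_1,c_1)$, $(b_2,c_2)$ are bi-free if the pairs of faces consisting of the unital algebras generated by $b_k$ (left) and by $c_k$ (right), $k=1,2$, are bi-free in the sense of Voiculescu. **Theorem 2.7.** There exist a $*$-probability space $(\mathcal A,\varphi)$ and an $R$-diagonal pair $(x,y)$ of elements of $\mathcal A$ such that $(xx^*,yy^*)$ and $(x^*x,y^*y)$ are not bi-free. Moreover, $(x,y)$ can be chosen such that $$\kappa_2(x,y^*)=\kappa_2(x^*,y)=\kappa_2(y,x^*)=\kappa_2(y^*,x)=1$$ (with $x,x^*$ on the left and $y,y^*$ on the right), while all other bi-free cumulants of $((x,x^*),(y,y^*))$, of every order $n\ge1$, vanish. -/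

import Mathlib

/-! ### Non-commutative probability spaces with involution -/

/-- `φ` makes the unital complex `*`-algebra `A` a `*`-probability space: it is linear, unital, and
satisfies `φ (a*) = conj (φ a)`. (No positivity is required.) -/
structure IsStarProbability {A : Type*} [Ring A] [StarRing A] [Algebra ℂ A] [StarModule ℂ A]
    (φ : A →ₗ[ℂ] ℂ) : Prop where
  map_one : φ 1 = 1
  map_star : ∀ a : A, φ (star a) = star (φ a)

/-- The two faces: left and right. -/
inductive Side where
  | l : Side
  | r : Side

/-! ### Bi-non-crossing partitions and bi-free cumulants -/

/-- The strict total order `≺_χ` on `{1, …, n}`: first the left positions in increasing order, then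
the right positions in decreasing order. -/
def chiLT {n : ℕ} (χ : Fin n → Side) (i j : Fin n) : Prop :=
  match χ i, χ j with
  | Side.l, Side.l => i < j
  | Side.l, Side.r => True
  | Side.r, Side.l => False
  | Side.r, Side.r => j < i

/-- A partition of a set `V` of positions is bi-non-crossing if it is non-crossing for the
order `≺_χ`: there are no `a ≺ b ≺ c ≺ d` with `a, c` in one block and `b, d` in a different one. -/
def IsBiNonCrossing {n : ℕ} (χ : Fin n → Side) {V : Finset (Fin n)} (π : Finpartition V) : Prop :=
  ∀ P ∈ π.parts, ∀ Q ∈ π.parts, ∀ a ∈ P, ∀ b ∈ Q, ∀ c ∈ P, ∀ d ∈ Q,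
    chiLT χ a b → chiLT χ b c → chiLT χ c d → P = Q

/-- The ordered product `a_{i₁} ⋯ a_{i_k}` for `V = {i₁ < ⋯ < i_k}`. -/
def orderedProd {A : Type*} [Ring A] {n : ℕ} (a : Fin n → A) (V : Finset (Fin n)) : A :=
  ((V.sort (· ≤ ·)).map a).prod

open Classical in
/-- The bi-free cumulant `κ_{χ|V}((a₁, …, aₙ)|V)` of the subtuple indexed by a non-empty set `V` of
positions. It is given recursively by the moment-cumulant formula
`φ(a_{i₁} ⋯ a_{i_k}) = ∑_{π ∈ BNC(χ|V)} ∏_{W ∈ π} κ_{χ|W}((a₁, …, aₙ)|W)`,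
solved for the term of the one-block partition; the sum below runs over the bi-non-crossing
partitions of `V` other than the one-block partition. -/
noncomputable def biFreeCumulantOn {A : Type*} [Ring A] [Algebra ℂ A] (φ : A →ₗ[ℂ] ℂ) {n : ℕ}
    (χ : Fin n → Side) (a : Fin n → A) (V : Finset (Fin n)) : ℂ :=
  φ (orderedProd a V) -
    ∑ π : {π : Finpartition V // IsBiNonCrossing χ π ∧ V ∉ π.parts},
      ∏ W : {W : Finset (Fin n) // W ∈ π.1.parts}, biFreeCumulantOn φ χ a W.1
termination_by V.card
decreasing_by
  exact Finset.card_lt_card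
    (lt_of_le_of_ne (π.1.le W.2) (fun h => π.2.2 (Eq.mp (congrArg (· ∈ π.1.parts) h) W.2)))

/-- The bi-free cumulant `κ_χ(a₁, …, aₙ)`. -/
noncomputable def biFreeCumulant {A : Type*} [Ring A] [Algebra ℂ A] (φ : A →ₗ[ℂ] ℂ) {n : ℕ}
    (χ : Fin n → Side) (a : Fin n → A) : ℂ :=
  biFreeCumulantOn φ χ a Finset.univ

/-! ### R-diagonal pairs -/

/-- The letter at a position on side `s`: `x` or `x*` on the left, `y` or `y*` on the right; the
letter is starred if and only if `e = true`. -/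
def starLetter {A : Type*} [Ring A] [StarRing A] (x y : A) (s : Side) (e : Bool) : A :=
  match s, e with
  | Side.l, false => x
  | Side.l, true => star x
  | Side.r, false => y
  | Side.r, true => star y

/-- The exponents `ω` alternate along the order `≺_χ`: any two consecutive positions for this order
carry different exponents. -/
def IsChiAlternating {n : ℕ} (χ : Fin n → Side) (ω : Fin n → Bool) : Prop :=
  ∀ i j : Fin n, chiLT χ i j → (∀ k : Fin n, ¬ (chiLT χ i k ∧ chiLT χ k j)) → ω i ≠ ω j

/-- The pair `(x, y)` is R-diagonal: a bi-free cumulant of `((x, x*), (y, y*))` vanishes unless it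
has even order and its entries, read in the order `≺_χ`, are alternatingly starred and
un-starred. -/
def IsRDiagonal {A : Type*} [Ring A] [StarRing A] [Algebra ℂ A] (φ : A →ₗ[ℂ] ℂ) (x y : A) : Prop :=
  ∀ (n : ℕ) (χ : Fin n → Side) (ω : Fin n → Bool), ¬ (Even n ∧ IsChiAlternating χ ω) →
    biFreeCumulant φ χ (fun k => starLetter x y (χ k) (ω k)) = 0

/-! ### Free products of vector spaces with a specified state vector -/

universe u

/-- A vector space with a specified state vector: a complex vector space `X = ℂ ξ ⊕ X°`, the
complement `X°` being given as the kernel of the functional `ψ` with `ψ ξ = 1`. -/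
structure StateSpace where
  carrier : Type u
  [addCommGroup : AddCommGroup carrier]
  [module : Module ℂ carrier]
  ξ : carrier
  ψ : carrier →ₗ[ℂ] ℂ
  ψ_ξ : ψ ξ = 1

attribute [instance] StateSpace.addCommGroup StateSpace.module

namespace StateSpace

/-- The complement `X°` of the line spanned by the state vector. -/
abbrev compl (X : StateSpace.{u}) : Submodule ℂ X.carrier := LinearMap.ker X.ψ

/-- The projection `X → X°` along the state vector. -/
def toCompl (X : StateSpace.{u}) : X.carrier →ₗ[ℂ] X.compl :=
  LinearMap.codRestrict X.compl (LinearMap.id - X.ψ.smulRight X.ξ)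
    (fun v => by simp [X.ψ_ξ])

section FreeProduct

variable {ι : Type*} (X : ι → StateSpace.{u})

/-- The tensor algebra of `⨁ i, X_i°`. The free product of the spaces `X_i` is the subspace
`freeProduct X` of it. -/
abbrev Fock := TensorAlgebra ℂ (DirectSum ι (fun i => (X i).compl))

/-- For `g : ⨁ i, X_i° → Fock X`, the operators `(f, d) ↦ (m f, g(m) f)`. -/
noncomputable def leftAct (g : DirectSum ι (fun i => (X i).compl) →ₗ[ℂ] Fock X) :
    DirectSum ι (fun i => (X i).compl) →ₗ[ℂ] Module.End ℂ (Fock X × Fock X) :=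
  LinearMap.mk₂ ℂ (fun m p => (TensorAlgebra.ι ℂ m * p.1, g m * p.1))
    (fun m m' p => by simp [add_mul]) (fun c m p => by simp)
    (fun m p p' => by simp [mul_add]) (fun c m p => by simp)

/-- For `g : ⨁ i, X_i° → Fock X`, the operators `(f, d) ↦ (f m, f g(m))`. -/
noncomputable def rightAct (g : DirectSum ι (fun i => (X i).compl) →ₗ[ℂ] Fock X) :
    DirectSum ι (fun i => (X i).compl) →ₗ[ℂ] Module.End ℂ (Fock X × Fock X) :=
  LinearMap.mk₂ ℂ (fun m p => (p.1 * TensorAlgebra.ι ℂ m, p.1 * g m))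
    (fun m m' p => by simp [mul_add]) (fun c m p => by simp)
    (fun m p p' => by simp [add_mul]) (fun c m p => by simp)

/-- The linear map `D` with `D 1 = d` and `D (m f) = g(m) f` for `m ∈ ⨁ i, X_i°`. -/
noncomputable def leftRec (d : Fock X)
    (g : DirectSum ι (fun i => (X i).compl) →ₗ[ℂ] Fock X) : Fock X →ₗ[ℂ] Fock X :=
  LinearMap.snd ℂ _ _ ∘ₗ LinearMap.applyₗ ((1 : Fock X), d) ∘ₗ
    (TensorAlgebra.lift ℂ (leftAct X g)).toLinearMap

/-- The linear map `D` with `D 1 = d` and `D (f m) = f g(m)` for `m ∈ ⨁ i, X_i°`. -/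
noncomputable def rightRec (d : Fock X)
    (g : DirectSum ι (fun i => (X i).compl) →ₗ[ℂ] Fock X) : Fock X →ₗ[ℂ] Fock X :=
  LinearMap.snd ℂ _ _ ∘ₗ LinearMap.applyₗ ((1 : Fock X), d) ∘ₗ
    (MulOpposite.opLinearEquiv ℂ).symm.toLinearMap ∘ₗ
    (TensorAlgebra.lift ℂ
      ((MulOpposite.opLinearEquiv ℂ).toLinearMap ∘ₗ rightAct X g)).toLinearMap

theorem leftRec_one (d : Fock X) (g : DirectSum ι (fun i => (X i).compl) →ₗ[ℂ] Fock X) :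
    leftRec X d g 1 = d := by
  simp [leftRec]

theorem leftRec_mul (d : Fock X) (g : DirectSum ι (fun i => (X i).compl) →ₗ[ℂ] Fock X)
    (m : DirectSum ι (fun i => (X i).compl)) (f : Fock X) :
    leftRec X d g (TensorAlgebra.ι ℂ m * f) = g m * f := by
  have key : ∀ f : Fock X, ((TensorAlgebra.lift ℂ (leftAct X g)) f ((1 : Fock X), d)).1 = f := by
    intro f
    have h : ∀ p : Fock X × Fock X, ((TensorAlgebra.lift ℂ (leftAct X g)) f p).1 = f * p.1 := by
      induction f using TensorAlgebra.induction with
      | algebraMap r => intro p; simp [Algebra.smul_def]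
      | ι m => intro p; simp [leftAct]
      | mul a b ha hb => intro p; simp [ha, hb, mul_assoc]
      | add a b ha hb => intro p; simp [ha, hb, add_mul]
    simpa using h (1, d)
  have h : leftRec X d g (TensorAlgebra.ι ℂ m * f) =
      g m * ((TensorAlgebra.lift ℂ (leftAct X g)) f ((1 : Fock X), d)).1 := by
    simp [leftRec, show ∀ p, leftAct X g m p = (TensorAlgebra.ι ℂ m * p.1, g m * p.1) from
      fun _ => rfl]
  rw [h, key]

theorem rightRec_one (d : Fock X) (g : DirectSum ι (fun i => (X i).compl) →ₗ[ℂ] Fock X) :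
    rightRec X d g 1 = d := by
  simp [rightRec]

theorem rightRec_mul (d : Fock X) (g : DirectSum ι (fun i => (X i).compl) →ₗ[ℂ] Fock X)
    (m : DirectSum ι (fun i => (X i).compl)) (f : Fock X) :
    rightRec X d g (f * TensorAlgebra.ι ℂ m) = f * g m := by
  have key : ∀ f : Fock X, (((TensorAlgebra.lift ℂ ((MulOpposite.opLinearEquiv ℂ).toLinearMap ∘ₗ
      rightAct X g)) f).unop ((1 : Fock X), d)).1 = f := by
    intro f
    have h : ∀ p : Fock X × Fock X, (((TensorAlgebra.lift ℂ
        ((MulOpposite.opLinearEquiv ℂ).toLinearMap ∘ₗ rightAct X g)) f).unop p).1 = p.1 * f := by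
      induction f using TensorAlgebra.induction with
      | algebraMap r => intro p; simp [Algebra.smul_def, Algebra.commutes]
      | ι m => intro p; simp [rightAct]
      | mul a b ha hb => intro p; simp [ha, hb, mul_assoc]
      | add a b ha hb => intro p; simp [ha, hb, mul_add]
    simpa using h (1, d)
  have h : rightRec X d g (f * TensorAlgebra.ι ℂ m) =
      (((TensorAlgebra.lift ℂ ((MulOpposite.opLinearEquiv ℂ).toLinearMap ∘ₗ
        rightAct X g)) f).unop ((1 : Fock X), d)).1 * g m := by
    simp [rightRec, show ∀ p, rightAct X g m p = (p.1 * TensorAlgebra.ι ℂ m, p.1 * g m) from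
      fun _ => rfl]
  rw [h, key]

variable [DecidableEq ι]

/-- A vector of `X_i°` as a tensor of degree one. -/
noncomputable def letter (i : ι) : (X i).compl →ₗ[ℂ] Fock X :=
  (TensorAlgebra.ι ℂ) ∘ₗ DirectSum.lof ℂ ι (fun i => (X i).compl) i

/-- The elementary tensor `h₁ ⊗ ⋯ ⊗ hₙ` with `h_k ∈ X_{i_k}°`; it is the vacuum `1` for `n = 0`. -/
noncomputable def tensorWord (w : List (Σ i, (X i).compl)) : Fock X :=
  (w.map (fun p => letter X p.1 p.2)).prod

/-- The free product of the `(X_i, X_i°, ξ_i)`, that is,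
`ℂ ξ ⊕ ⨁_{n ≥ 1} ⨁_{i₁ ≠ i₂ ≠ ⋯ ≠ iₙ} X_{i₁}° ⊗ ⋯ ⊗ X_{iₙ}°`, where the state vector `ξ` is
the vacuum `1`. -/
noncomputable def freeProduct : Submodule ℂ (Fock X) :=
  Submodule.span ℂ
    {f | ∃ w : List (Σ i, (X i).compl), w.IsChain (fun p q => p.1 ≠ q.1) ∧ f = tensorWord X w}

/-- The embedding `X_i = ℂ ξ_i ⊕ X_i° → ℂ ξ ⊕ X_i°`, sending `ξ_i` to the vacuum. -/
noncomputable def embed (i : ι) : (X i).carrier →ₗ[ℂ] Fock X :=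
  (Algebra.linearMap ℂ (Fock X)) ∘ₗ (X i).ψ + letter X i ∘ₗ (X i).toCompl

/-- The action of `T ∈ L(X_i)` on the left-most tensor factor, before restriction to the free
product: with `v ⊗ f` standing for `embed v * f`, it sends the vacuum `ξ = ξ_i ⊗ ξ` to `T ξ_i ⊗ ξ`,
a tensor `h ⊗ f` with `h ∈ X_i°` to `T h ⊗ f`, and a tensor `m ⊗ f = ξ_i ⊗ (m ⊗ f)` with
`m ∈ X_j°`, `j ≠ i`, to `T ξ_i ⊗ (m ⊗ f)`. -/
noncomputable def leftFock (i : ι) (T : Module.End ℂ (X i).carrier) : Fock X →ₗ[ℂ] Fock X :=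
  leftRec X (embed X i (T (X i).ξ))
    (embed X i ∘ₗ T ∘ₗ (X i).compl.subtype ∘ₗ DirectSum.component ℂ ι _ i +
      LinearMap.mulLeft ℂ (embed X i (T (X i).ξ)) ∘ₗ TensorAlgebra.ι ℂ ∘ₗ
        (LinearMap.id - DirectSum.lof ℂ ι _ i ∘ₗ DirectSum.component ℂ ι _ i))

/-- The action of `T ∈ L(X_i)` on the right-most tensor factor, before restriction to the free
product; it is the mirror image of `leftFock`. -/
noncomputable def rightFock (i : ι) (T : Module.End ℂ (X i).carrier) : Fock X →ₗ[ℂ] Fock X :=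
  rightRec X (embed X i (T (X i).ξ))
    (embed X i ∘ₗ T ∘ₗ (X i).compl.subtype ∘ₗ DirectSum.component ℂ ι _ i +
      LinearMap.mulRight ℂ (embed X i (T (X i).ξ)) ∘ₗ TensorAlgebra.ι ℂ ∘ₗ
        (LinearMap.id - DirectSum.lof ℂ ι _ i ∘ₗ DirectSum.component ℂ ι _ i))

theorem leftFock_one (i : ι) (T : Module.End ℂ (X i).carrier) :
    leftFock X i T 1 = embed X i (T (X i).ξ) := leftRec_one X _ _

theorem leftFock_letter_same (i : ι) (T : Module.End ℂ (X i).carrier) (h : (X i).compl)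
    (f : Fock X) : leftFock X i T (letter X i h * f) = embed X i (T h) * f := by
  simp [leftFock, letter, leftRec_mul, DirectSum.component.lof_self]

theorem leftFock_letter_ne {i j : ι} (hij : j ≠ i) (T : Module.End ℂ (X i).carrier)
    (h : (X j).compl) (f : Fock X) :
    leftFock X i T (letter X j h * f) = embed X i (T (X i).ξ) * (letter X j h * f) := by
  simp [leftFock, letter, leftRec_mul, DirectSum.component.of, hij, mul_assoc]

theorem rightFock_one (i : ι) (T : Module.End ℂ (X i).carrier) :
    rightFock X i T 1 = embed X i (T (X i).ξ) := rightRec_one X _ _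

theorem rightFock_letter_same (i : ι) (T : Module.End ℂ (X i).carrier) (h : (X i).compl)
    (f : Fock X) : rightFock X i T (f * letter X i h) = f * embed X i (T h) := by
  simp [rightFock, letter, rightRec_mul, DirectSum.component.lof_self]

theorem rightFock_letter_ne {i j : ι} (hij : j ≠ i) (T : Module.End ℂ (X i).carrier)
    (h : (X j).compl) (f : Fock X) :
    rightFock X i T (f * letter X j h) = f * letter X j h * embed X i (T (X i).ξ) := by
  simp [rightFock, letter, rightRec_mul, DirectSum.component.of, hij, mul_assoc]

theorem tensorWord_mem {w : List (Σ i, (X i).compl)} (hw : w.IsChain (fun p q => p.1 ≠ q.1)) :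
    tensorWord X w ∈ freeProduct X := Submodule.subset_span ⟨w, hw, rfl⟩

theorem embed_mul_mem (i : ι) (v : (X i).carrier) {w : List (Σ i, (X i).compl)}
    (hw : w.IsChain (fun p q => p.1 ≠ q.1)) (hi : ∀ p ∈ w.head?, p.1 ≠ i) :
    embed X i v * tensorWord X w ∈ freeProduct X := by
  have h1 : embed X i v * tensorWord X w =
      (X i).ψ v • tensorWord X w + tensorWord X (⟨i, (X i).toCompl v⟩ :: w) := by
    simp [embed, tensorWord, add_mul, Algebra.smul_def]
  rw [h1]
  refine add_mem (Submodule.smul_mem _ _ (tensorWord_mem X hw)) (tensorWord_mem X ?_)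
  rw [List.isChain_cons]
  exact ⟨fun p hp => (hi p hp).symm, hw⟩

theorem mul_embed_mem (i : ι) (v : (X i).carrier) {w : List (Σ i, (X i).compl)}
    (hw : w.IsChain (fun p q => p.1 ≠ q.1)) (hi : ∀ p ∈ w.getLast?, p.1 ≠ i) :
    tensorWord X w * embed X i v ∈ freeProduct X := by
  have h1 : tensorWord X w * embed X i v =
      (X i).ψ v • tensorWord X w + tensorWord X (w ++ [⟨i, (X i).toCompl v⟩]) := by
    simp [embed, tensorWord, mul_add, Algebra.smul_def, Algebra.commutes]
  rw [h1]
  refine add_mem (Submodule.smul_mem _ _ (tensorWord_mem X hw)) (tensorWord_mem X ?_)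
  rw [List.isChain_append]
  refine ⟨hw, List.isChain_singleton _, fun p hp q hq => ?_⟩
  simp only [List.head?_cons, Option.mem_def, Option.some.injEq] at hq
  subst hq
  exact hi p hp

theorem leftFock_mem (i : ι) (T : Module.End ℂ (X i).carrier) :
    ∀ f ∈ freeProduct X, leftFock X i T f ∈ freeProduct X := by
  intro f hf
  refine Submodule.span_induction (p := fun f _ => leftFock X i T f ∈ freeProduct X)
    ?_ (by simp) (fun a b _ _ ha hb => by simpa using add_mem ha hb)
    (fun c a _ ha => by simpa using Submodule.smul_mem _ c ha) hf
  rintro _ ⟨w, hw, rfl⟩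
  cases w with
  | nil =>
    have h := embed_mul_mem X i (T (X i).ξ) (w := []) List.isChain_nil (by simp)
    simpa [tensorWord, leftFock_one] using h
  | cons p w =>
    obtain ⟨j, h⟩ := p
    have hw' := List.isChain_cons.1 hw
    have hs : tensorWord X (⟨j, h⟩ :: w) = letter X j h * tensorWord X w := by simp [tensorWord]
    by_cases hij : j = i
    · subst hij
      rw [hs, leftFock_letter_same]
      exact embed_mul_mem X j _ hw'.2 (fun p hp => (hw'.1 p hp).symm)
    · rw [hs, leftFock_letter_ne X hij, ← hs]
      exact embed_mul_mem X i _ hw (by simpa using hij)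

theorem rightFock_mem (i : ι) (T : Module.End ℂ (X i).carrier) :
    ∀ f ∈ freeProduct X, rightFock X i T f ∈ freeProduct X := by
  intro f hf
  refine Submodule.span_induction (p := fun f _ => rightFock X i T f ∈ freeProduct X)
    ?_ (by simp) (fun a b _ _ ha hb => by simpa using add_mem ha hb)
    (fun c a _ ha => by simpa using Submodule.smul_mem _ c ha) hf
  rintro _ ⟨w, hw, rfl⟩
  rcases List.eq_nil_or_concat w with rfl | ⟨w, p, rfl⟩
  · have h := mul_embed_mem X i (T (X i).ξ) (w := []) List.isChain_nil (by simp)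
    simpa [tensorWord, rightFock_one] using h
  · obtain ⟨j, h⟩ := p
    rw [List.concat_eq_append] at hw ⊢
    have hw' := List.isChain_append.1 hw
    have hs : tensorWord X (w ++ [⟨j, h⟩]) = tensorWord X w * letter X j h := by simp [tensorWord]
    by_cases hij : j = i
    · subst hij
      rw [hs, rightFock_letter_same]
      exact mul_embed_mem X j _ hw'.1 (fun p hp => hw'.2.2 p hp ⟨j, h⟩ (by simp))
    · rw [hs, rightFock_letter_ne X hij, ← hs]
      exact mul_embed_mem X i _ hw (by simpa using hij)

/-- The left representation `λ_i : L(X_i) → L(X)` on the free product `X`. -/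
noncomputable def leftOp (i : ι) (T : Module.End ℂ (X i).carrier) :
    Module.End ℂ (freeProduct X) :=
  (leftFock X i T).restrict (leftFock_mem X i T)

/-- The right representation `ρ_i : L(X_i) → L(X)` on the free product `X`. -/
noncomputable def rightOp (i : ι) (T : Module.End ℂ (X i).carrier) :
    Module.End ℂ (freeProduct X) :=
  (rightFock X i T).restrict (rightFock_mem X i T)

/-- The state vector `ξ` of the free product. -/
noncomputable def vacuum : freeProduct X := ⟨1, tensorWord_mem X List.isChain_nil⟩

/-- The functional on the free product that gives the coefficient of the state vector `ξ`; it
vanishes on all tensors of positive degree. -/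
noncomputable def vacuumCoeff : freeProduct X →ₗ[ℂ] ℂ :=
  TensorAlgebra.algebraMapInv.toLinearMap ∘ₗ (freeProduct X).subtype

end FreeProduct

end StateSpace

/-! ### Bi-freeness -/

open StateSpace in
/-- Voiculescu's bi-freeness of a family `(B_k, C_k)` of pairs of faces (unital subalgebras of
`A`): there are vector spaces with specified state vectors `X_k` and unital representations of `B_k`
and `C_k` on `X_k` such that the joint distribution of all the `B_k`, `C_k` with respect to `φ` is
that of the operators `λ_k(l_k(b))`, `ρ_k(r_k(c))` on the free product of the `X_k`, with respect to
the vacuum. (The distribution is the collection of all the mixed moments; the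
universe of the `X_k` is that of `A`, which is enough, since one may always take for `X_k` the free
product of algebras `B_k * C_k` with its canonical functional.) -/
def IsBiFree {A : Type u} [Ring A] [Algebra ℂ A] (φ : A →ₗ[ℂ] ℂ) {ι : Type*} [DecidableEq ι]
    (B C : ι → Subalgebra ℂ A) : Prop :=
  ∃ (X : ι → StateSpace.{u})
    (l : ∀ k, B k →ₐ[ℂ] Module.End ℂ (X k).carrier)
    (r : ∀ k, C k →ₐ[ℂ] Module.End ℂ (X k).carrier),
    ∀ w : List (Σ k, (B k ⊕ C k)),
      φ (w.map (fun p => (match p with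
        | ⟨_, Sum.inl b⟩ => (b : A)
        | ⟨_, Sum.inr c⟩ => (c : A) : A))).prod =
      vacuumCoeff X ((w.map (fun p => (match p with
        | ⟨k, Sum.inl b⟩ => leftOp X k (l k b)
        | ⟨k, Sum.inr c⟩ => rightOp X k (r k c) : Module.End ℂ (freeProduct X)))).prod
          (vacuum X))

/-- Bi-freeness of two pairs `(b₁, c₁)`, `(b₂, c₂)` of random variables: bi-freeness of the pairs of
faces formed by the unital algebras that the left and the right variables generate. -/
def AreBiFreePairs {A : Type u} [Ring A] [Algebra ℂ A] (φ : A →ₗ[ℂ] ℂ) (p q : A × A) : Prop :=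
  IsBiFree φ (fun k : Fin 2 => Algebra.adjoin ℂ {(![p, q] k).1})
    (fun k : Fin 2 => Algebra.adjoin ℂ {(![p, q] k).2})

/-! Positivity is not required, so a real, star-invariant function on words, with value 1 at the
empty word, extends to a state. The model is the monoid algebra of pairs (word in `x, x*`; word in
`y, y*`), in which left letters commute with right letters; the state is the indicator of pairs of
words with opposite exponents, letter by letter.

To identify the cumulants, take as candidate the indicator of a left and a right position with
different exponents. The moment-cumulant sum then counts bi-non-crossing partitions into such pairs.
Since `≺_χ` reverses the right positions, non-crossing means that the k-th left position is paired
with the k-th right one. So at most one such partition exists, and it exists exactly when the two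
words are opposite: the count is the moment (`sum_prod_isOppositePair`, `state_orderedProd`). The
recursion determines the cumulants, so the candidate is correct (`biFreeCumulantOn_letter`), and
R-diagonality is immediate.

Bi-freeness would force `φ(bc) = φ(b)φ(c)` for a left `b` of one pair and a right `c` of the other
(`AreBiFreePairs.map_mul`). But `xx*` and `y*y` have opposite exponents, so `φ(xx* y*y) = 1`,
whereas `φ(xx*) = φ(y*y) = 0`. -/

section StarMonoidAlgebra

/-! ### The monoid algebra as a complex star-algebra. -/

variable {M : Type*} [Monoid M] [StarMul M]

/-- The involution `∑ c_m m ↦ ∑ conj c_m m*` of the monoid algebra of a monoid with involution. -/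
noncomputable def starMonoidAlgebraHom : MonoidAlgebra ℂ M →+ MonoidAlgebra ℂ M :=
  MonoidAlgebra.coeffAddEquiv.symm.toAddMonoidHom.comp
    (((Finsupp.mapRange.addMonoidHom (starAddEquiv (R := ℂ)).toAddMonoidHom).comp
      (Finsupp.mapDomain.addMonoidHom star)).comp MonoidAlgebra.coeffAddEquiv.toAddMonoidHom)

theorem starMonoidAlgebraHom_single (m : M) (c : ℂ) :
    starMonoidAlgebraHom (MonoidAlgebra.single m c) = MonoidAlgebra.single (star m) (star c) := by
  simp [starMonoidAlgebraHom]

noncomputable instance : StarRing (MonoidAlgebra ℂ M) where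
  star := starMonoidAlgebraHom
  star_involutive f := by
    induction f using MonoidAlgebra.induction_linear with
    | zero => simp
    | add f g hf hg => rw [map_add, map_add, hf, hg]
    | single m c => simp [starMonoidAlgebraHom_single]
  star_add := map_add _
  star_mul f g := by
    change starMonoidAlgebraHom (f * g) = starMonoidAlgebraHom g * starMonoidAlgebraHom f
    induction f using MonoidAlgebra.induction_linear with
    | zero => simp
    | add f f' hf hf' => rw [add_mul, map_add, map_add, hf, hf', mul_add]
    | single m c =>
      induction g using MonoidAlgebra.induction_linear with
      | zero => simp
      | add g g' hg hg' => rw [mul_add, map_add, map_add, hg, hg', add_mul]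
      | single m' c' =>
        simp [MonoidAlgebra.single_mul_single, starMonoidAlgebraHom_single, mul_comm c]

theorem star_single (m : M) (c : ℂ) :
    star (MonoidAlgebra.single m c) = MonoidAlgebra.single (star m) (star c) :=
  starMonoidAlgebraHom_single m c

instance : StarModule ℂ (MonoidAlgebra ℂ M) where
  star_smul c f := by
    induction f using MonoidAlgebra.induction_linear with
    | zero => simp
    | add f g hf hg => rw [smul_add, star_add, star_add, hf, hg, smul_add]
    | single m d => simp [star_single]

end StarMonoidAlgebra

/-! ### Words in `x, x*` and `y, y*` -/

/-- Pairs of a word in `x, x*` and a word in `y, y*`; the starred letters are written `true`. -/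
def BiWord : Type := FreeMonoid Bool × FreeMonoid Bool

namespace BiWord

instance : Monoid BiWord := inferInstanceAs (Monoid (FreeMonoid Bool × FreeMonoid Bool))

/-- The pair of words formed by two lists of exponents. -/
def mk (u v : List Bool) : BiWord := (FreeMonoid.ofList u, FreeMonoid.ofList v)

/-- The word in `x, x*`. -/
def left (p : BiWord) : List Bool := p.1.toList

/-- The word in `y, y*`. -/
def right (p : BiWord) : List Bool := p.2.toList

@[simp] theorem left_mk (u v : List Bool) : (mk u v).left = u := rfl
@[simp] theorem right_mk (u v : List Bool) : (mk u v).right = v := rfl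
@[simp] theorem left_one : (1 : BiWord).left = [] := rfl
@[simp] theorem right_one : (1 : BiWord).right = [] := rfl
@[simp] theorem left_mul (p q : BiWord) : (p * q).left = p.left ++ q.left := rfl
@[simp] theorem right_mul (p q : BiWord) : (p * q).right = p.right ++ q.right := rfl

@[ext] theorem ext {p q : BiWord} (h : p.left = q.left) (h' : p.right = q.right) : p = q :=
  Prod.ext h h'

/-- Besides reversing each word, the involution exchanges starred and un-starred letters, so that
`x` and `x*` are adjoint to each other. -/
instance : StarMul BiWord where
  star p := mk (p.left.map not).reverse (p.right.map not).reverse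
  star_involutive p := by ext1 <;> simp [Function.comp_def]
  star_mul p q := by ext1 <;> simp

theorem star_def (p : BiWord) :
    star p = mk (p.left.map not).reverse (p.right.map not).reverse := rfl

/-- The word in `y, y*` is obtained from the word in `x, x*` by exchanging starred and un-starred
letters. -/
def IsMatched (p : BiWord) : Prop := p.right = p.left.map not

/-- Both words undergo the same reversal and negation, which are injective and commute with the
negation in the matching condition. This makes the state hermitian. -/
theorem isMatched_star (p : BiWord) : (star p).IsMatched ↔ p.IsMatched := by
  simp only [IsMatched, star_def, left_mk, right_mk, List.map_reverse, List.reverse_inj]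
  exact (List.map_injective_iff.2 Bool.not_injective).eq_iff

/-- The letter `x`, `x*`, `y` or `y*`. -/
def letter (s : Side) (e : Bool) : BiWord :=
  match s with
  | Side.l => mk [e] []
  | Side.r => mk [] [e]

open Classical in
/-- The functional whose value is `1` at the matched words and `0` at all other words. -/
noncomputable def state : MonoidAlgebra ℂ BiWord →ₗ[ℂ] ℂ :=
  Finsupp.linearCombination ℂ (fun p : BiWord => if p.IsMatched then (1 : ℂ) else 0) ∘ₗ
    (MonoidAlgebra.coeffLinearEquiv ℂ).toLinearMap

open Classical in
theorem state_single (p : BiWord) (c : ℂ) :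
    state (MonoidAlgebra.single p c) = if p.IsMatched then c else 0 := by
  simp [state]

theorem isStarProbability_state : IsStarProbability state where
  map_one := by simp [MonoidAlgebra.one_def, state_single, IsMatched]
  map_star f := by
    induction f using MonoidAlgebra.induction_linear with
    | zero => simp
    | add f g hf hg => rw [star_add, map_add, map_add, hf, hg, star_add]
    | single p c =>
      by_cases h : p.IsMatched <;> simp [star_single, state_single, isMatched_star, h]

theorem starLetter_single (s : Side) (e : Bool) :
    starLetter (MonoidAlgebra.single (letter Side.l false) (1 : ℂ))
      (MonoidAlgebra.single (letter Side.r false) 1) s e =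
      MonoidAlgebra.single (letter s e) 1 := by
  cases s <;> cases e <;> simp [starLetter, star_single, star_def, letter]

end BiWord

/-! ### Factorization of mixed moments under bi-freeness. -/

namespace StateSpace
variable {ι : Type*} [DecidableEq ι] (X : ι → StateSpace.{u})

/-- The mixed vacuum moments of a left operator and a right operator of different spaces factor. -/
theorem vacuumCoeff_leftOp_rightOp {i j : ι} (hij : i ≠ j) (T : Module.End ℂ (X i).carrier)
    (S : Module.End ℂ (X j).carrier) :
    vacuumCoeff X (leftOp X i T (rightOp X j S (vacuum X))) =
      (X i).ψ (T (X i).ξ) * (X j).ψ (S (X j).ξ) := by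
  -- Split `S ξ_j` into its vacuum part and its part in `X_j°`; since `i ≠ j`, `T` acts on the
  -- latter by tensoring `T ξ_i` on the left. That term ends in a letter, so it has no vacuum
  -- coefficient.
  have h : leftFock X i T (rightFock X j S 1) =
      (X j).ψ (S (X j).ξ) • embed X i (T (X i).ξ) +
        embed X i (T (X i).ξ) * letter X j ((X j).toCompl (S (X j).ξ)) := by
    have h1 := leftFock_letter_ne X hij.symm T ((X j).toCompl (S (X j).ξ)) 1
    rw [mul_one] at h1
    rw [rightFock_one]
    conv_lhs => rw [embed]
    simp only [LinearMap.add_apply, LinearMap.comp_apply, map_add, h1, Algebra.linearMap_apply,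
      Algebra.algebraMap_eq_smul_one, map_smul, leftFock_one]
  simp [vacuumCoeff, leftOp, rightOp, vacuum, h, embed, letter, TensorAlgebra.algebraMapInv,
    mul_comm]

theorem vacuumCoeff_leftOp (i : ι) (T : Module.End ℂ (X i).carrier) :
    vacuumCoeff X (leftOp X i T (vacuum X)) = (X i).ψ (T (X i).ξ) := by
  simp [vacuumCoeff, leftOp, vacuum, leftFock_one, embed, letter, TensorAlgebra.algebraMapInv]

theorem vacuumCoeff_rightOp (i : ι) (T : Module.End ℂ (X i).carrier) :
    vacuumCoeff X (rightOp X i T (vacuum X)) = (X i).ψ (T (X i).ξ) := by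
  simp [vacuumCoeff, rightOp, vacuum, rightFock_one, embed, letter, TensorAlgebra.algebraMapInv]

end StateSpace

/-- Compare the joint distributions on the words `bc`, `b` and `c` only. -/
theorem IsBiFree.map_mul {A : Type*} [Ring A] [Algebra ℂ A] {φ : A →ₗ[ℂ] ℂ} {ι : Type*}
    [DecidableEq ι] {B C : ι → Subalgebra ℂ A} (h : IsBiFree φ B C) {i j : ι} (hij : i ≠ j)
    (b : B i) (c : C j) : φ (b * c) = φ b * φ c := by
  obtain ⟨X, l, r, h⟩ := h
  have hbc := h [⟨i, Sum.inl b⟩, ⟨j, Sum.inr c⟩]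
  have hb := h [⟨i, Sum.inl b⟩]
  have hc := h [⟨j, Sum.inr c⟩]
  simp only [List.map_cons, List.map_nil, List.prod_cons, List.prod_nil, mul_one,
    Module.End.mul_apply] at hbc hb hc
  rw [hbc, hb, hc, StateSpace.vacuumCoeff_leftOp_rightOp X hij, StateSpace.vacuumCoeff_leftOp,
    StateSpace.vacuumCoeff_rightOp]

theorem AreBiFreePairs.map_mul {A : Type*} [Ring A] [Algebra ℂ A] {φ : A →ₗ[ℂ] ℂ}
    {p q : A × A} (h : AreBiFreePairs φ p q) : φ (p.1 * q.2) = φ p.1 * φ q.2 :=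
  IsBiFree.map_mul h (i := 0) (j := 1) (by decide)
    ⟨p.1, Algebra.subset_adjoin rfl⟩ ⟨q.2, Algebra.subset_adjoin rfl⟩

/-! ### Bi-non-crossing partitions into pairs -/

/-- Turns an increasing matching of positions into an equality of lists, hence of words of
exponents. -/
theorem StrictMonoOn.map_sort_image {α β : Type*} [LinearOrder α] [LinearOrder β] {f : α → β}
    {s : Finset α} (hf : StrictMonoOn f s) : s.sort.map f = (s.image f).sort := by
  refine List.SortedLT.eq_of_mem_iff ?_ (s.image f).sortedLT_sort (by simp)
  refine (List.pairwise_map.2 (s.sortedLT_sort.pairwise.imp_of_mem fun ha hb hab => ?_)).sortedLT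
  exact hf (by simpa using ha) (by simpa using hb) hab

section Pairings

variable {n : ℕ} (χ : Fin n → Side) (ω : Fin n → Bool)

open Classical in
/-- The left positions in `V`. -/
noncomputable def leftPositions (V : Finset (Fin n)) : Finset (Fin n) :=
  V.filter (fun i => χ i = Side.l)

open Classical in
/-- The right positions in `V`. -/
noncomputable def rightPositions (V : Finset (Fin n)) : Finset (Fin n) :=
  V.filter (fun i => χ i = Side.r)

variable {χ} in
theorem mem_leftPositions {V : Finset (Fin n)} {i : Fin n} :
    i ∈ leftPositions χ V ↔ i ∈ V ∧ χ i = Side.l := by simp [leftPositions]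

variable {χ} in
theorem mem_rightPositions {V : Finset (Fin n)} {i : Fin n} :
    i ∈ rightPositions χ V ↔ i ∈ V ∧ χ i = Side.r := by simp [rightPositions]

/-- `W` consists of a left and a right position that carry different exponents. -/
def IsOppositePair (W : Finset (Fin n)) : Prop :=
  ∃ i j, W = {i, j} ∧ χ i = Side.l ∧ χ j = Side.r ∧ ω i ≠ ω j

/-- A bi-non-crossing partition into opposite pairs. -/
structure IsOppositePairing {V : Finset (Fin n)} (π : Finpartition V) : Prop where
  isBiNonCrossing : IsBiNonCrossing χ π
  isOppositePair : ∀ W ∈ π.parts, IsOppositePair χ ω W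

/-- The exponents at the right positions of `V` are opposite to those at the left positions. -/
def HasOppositeWords (V : Finset (Fin n)) : Prop :=
  (rightPositions χ V).sort.map ω = ((leftPositions χ V).sort.map ω).map not

variable {χ ω}

theorem pair_left_unique {i i' j j' : Fin n} (hi : χ i = Side.l) (hj' : χ j' = Side.r)
    (h : ({i, j} : Finset (Fin n)) = {i', j'}) : i = i' := by
  have : i ∈ ({i', j'} : Finset (Fin n)) := h ▸ Finset.mem_insert_self i {j}
  simp only [Finset.mem_insert, Finset.mem_singleton] at this
  rcases this with rfl | rfl
  · rfl
  · rw [hi] at hj'; cases hj'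

/-- The order-preserving matching of left and right positions that a pairing consists of. -/
theorem IsOppositePairing.exists_matching {V : Finset (Fin n)} {π : Finpartition V}
    (hπ : IsOppositePairing χ ω π) :
    ∃ f : Fin n → Fin n, StrictMonoOn f (leftPositions χ V) ∧
      (leftPositions χ V).image f = rightPositions χ V ∧
      (∀ i ∈ leftPositions χ V, ω (f i) = !ω i) ∧
      π.parts = (leftPositions χ V).image (fun i => {i, f i}) := by
  have key : ∀ i, ∃ j, i ∈ leftPositions χ V →
      χ j = Side.r ∧ ω j = (!ω i) ∧ ({i, j} : Finset (Fin n)) ∈ π.parts := by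
    intro i
    by_cases hi : i ∈ leftPositions χ V
    · obtain ⟨hiV, hil⟩ := mem_leftPositions.1 hi
      obtain ⟨W, hW, hiW⟩ := π.exists_mem hiV
      obtain ⟨a, b, rfl, ha, hb, hab⟩ := hπ.isOppositePair W hW
      simp only [Finset.mem_insert, Finset.mem_singleton] at hiW
      rcases hiW with rfl | rfl
      · exact ⟨b, fun _ => ⟨hb, by revert hab; cases ω i <;> cases ω b <;> simp, hW⟩⟩
      · rw [hil] at hb; cases hb
    -- Off the left positions the value of the matching is irrelevant.
    · exact ⟨i, fun h => absurd h hi⟩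
  choose f hf using key
  have hinj : ∀ i ∈ leftPositions χ V, ∀ i' ∈ leftPositions χ V,
      ({i, f i} : Finset (Fin n)) = {i', f i'} → i = i' := fun i hi i' hi' h =>
    pair_left_unique (mem_leftPositions.1 hi).2 (hf i' hi').1 h
  have hparts : π.parts = (leftPositions χ V).image (fun i => {i, f i}) := by
    ext W
    simp only [Finset.mem_image]
    constructor
    · intro hW
      obtain ⟨a, b, rfl, ha, hb, hab⟩ := hπ.isOppositePair W hW
      have haV : a ∈ leftPositions χ V :=
        mem_leftPositions.2 ⟨π.subset hW (Finset.mem_insert_self _ _), ha⟩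
      exact ⟨a, haV, π.eq_of_mem_parts (hf a haV).2.2 hW (Finset.mem_insert_self _ _)
        (Finset.mem_insert_self _ _)⟩
    · rintro ⟨i, hi, rfl⟩
      exact (hf i hi).2.2
  refine ⟨f, ?_, ?_, fun i hi => (hf i hi).2.1, hparts⟩
  · intro i hi i' hi' hlt
    have hi := Finset.mem_coe.1 hi
    have hi' := Finset.mem_coe.1 hi'
    obtain ⟨hr, -, hP⟩ := hf i hi
    obtain ⟨hr', -, hQ⟩ := hf i' hi'
    have hl := (mem_leftPositions.1 hi).2
    have hl' := (mem_leftPositions.1 hi').2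
    -- If `f i' < f i`, then `i ≺ i' ≺ f i ≺ f i'`, the right positions being reversed, and this is
    -- a crossing. If `f i' = f i`, the two blocks share an element. Either way the blocks coincide,
    -- so `i = i'`.
    by_contra hle
    rcases (not_lt.1 hle).lt_or_eq with h | h
    · exact hlt.ne (hinj i hi i' hi' (hπ.isBiNonCrossing _ hP _ hQ i (by simp) i' (by simp)
        (f i) (by simp) (f i') (by simp) (by simpa [chiLT, hl, hl'] using hlt)
        (by simp [chiLT, hl', hr]) (by simpa [chiLT, hr, hr'] using h)))
    · exact hlt.ne (hinj i hi i' hi' (π.eq_of_mem_parts hP hQ (a := f i) (by simp)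
        (by simp [h])))
  · ext j
    simp only [Finset.mem_image]
    constructor
    · rintro ⟨i, hi, rfl⟩
      exact mem_rightPositions.2 ⟨π.subset (hf i hi).2.2 (by simp), (hf i hi).1⟩
    · intro hj
      obtain ⟨hjV, hjr⟩ := mem_rightPositions.1 hj
      obtain ⟨W, hW, hjW⟩ := π.exists_mem hjV
      rw [hparts] at hW
      obtain ⟨i, hi, rfl⟩ := Finset.mem_image.1 hW
      simp only [Finset.mem_insert, Finset.mem_singleton] at hjW
      rcases hjW with rfl | rfl
      · rw [(mem_leftPositions.1 hi).2] at hjr; cases hjr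
      · exact ⟨i, hi, rfl⟩

theorem IsOppositePairing.hasOppositeWords {V : Finset (Fin n)} {π : Finpartition V}
    (hπ : IsOppositePairing χ ω π) : HasOppositeWords χ ω V := by
  obtain ⟨f, hf, himg, hω, -⟩ := hπ.exists_matching
  rw [HasOppositeWords, ← himg, ← hf.map_sort_image, List.map_map, List.map_map]
  exact List.map_congr_left fun i hi => hω i ((Finset.mem_sort _).1 hi)

/-- Both matchings are increasing with the same image, so they list the right positions in the same
order and agree at each left position. -/
theorem IsOppositePairing.unique {V : Finset (Fin n)} {π π' : Finpartition V}
    (hπ : IsOppositePairing χ ω π) (hπ' : IsOppositePairing χ ω π') : π = π' := by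
  obtain ⟨f, hf, himg, -, hparts⟩ := hπ.exists_matching
  obtain ⟨f', hf', himg', -, hparts'⟩ := hπ'.exists_matching
  have h := himg.trans himg'.symm
  have h' := congrArg (fun s : Finset (Fin n) => s.sort) h
  simp only [← hf.map_sort_image, ← hf'.map_sort_image, List.map_inj_left, Finset.mem_sort] at h'
  refine Finpartition.ext ?_
  rw [hparts, hparts']
  exact Finset.image_congr fun i hi => by simp only [h' i hi]

theorem HasOppositeWords.exists_isOppositePairing {V : Finset (Fin n)}
    (h : HasOppositeWords χ ω V) : ∃ π : Finpartition V, IsOppositePairing χ ω π := by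
  obtain ⟨f, hf, himg⟩ : ∃ f : Fin n → Fin n, StrictMonoOn f (leftPositions χ V) ∧
      (leftPositions χ V).image f = rightPositions χ V := by
    have hc : (rightPositions χ V).card = (leftPositions χ V).card := by
      simpa [HasOppositeWords] using congrArg List.length h
    -- The k-th left position goes to the k-th right position; the numbers agree because opposite
    -- words have equal length.
    let e := ((leftPositions χ V).orderIsoOfFin rfl).symm.trans
      ((rightPositions χ V).orderIsoOfFin hc)
    refine ⟨fun i => if hi : i ∈ leftPositions χ V then e ⟨i, hi⟩ else i, ?_, ?_⟩
    · intro i hi i' hi' hlt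
      have hi := Finset.mem_coe.1 hi
      have hi' := Finset.mem_coe.1 hi'
      simp only [hi, hi', dif_pos, Subtype.coe_lt_coe]
      exact e.strictMono hlt
    · ext j
      simp only [Finset.mem_image]
      constructor
      · rintro ⟨i, hi, rfl⟩
        simp only [hi, dif_pos]
        exact (e ⟨i, hi⟩).2
      · intro hj
        refine ⟨e.symm ⟨j, hj⟩, (e.symm ⟨j, hj⟩).2, ?_⟩
        simp
  have hω : ∀ i ∈ leftPositions χ V, ω (f i) = !ω i := by
    rw [HasOppositeWords, ← himg, ← hf.map_sort_image, List.map_map, List.map_map] at h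
    exact fun i hi => List.map_inj_left.1 h i ((Finset.mem_sort _).2 hi)
  have hfr : ∀ i ∈ leftPositions χ V, f i ∈ V ∧ χ (f i) = Side.r := fun i hi =>
    mem_rightPositions.1 (himg ▸ Finset.mem_image_of_mem f hi)
  have hl : ∀ i ∈ leftPositions χ V, i ∈ V ∧ χ i = Side.l := fun i hi => mem_leftPositions.1 hi
  have hne : ∀ {i j : Fin n}, χ i = Side.l → χ j = Side.r → i ≠ j := by
    rintro i _ hi hj rfl
    rw [hi] at hj; cases hj
  let π : Finpartition V := Finpartition.ofExistsUnique
    ((leftPositions χ V).image (fun i => ({i, f i} : Finset (Fin n))))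
    (by
      intro P hP
      obtain ⟨i, hi, rfl⟩ := Finset.mem_image.1 hP
      simp [Finset.insert_subset_iff, hl i hi, hfr i hi])
    (by
      have main : ∀ i ∈ leftPositions χ V, ∀ j ∈ ({i, f i} : Finset (Fin n)),
          ∃! W, W ∈ (leftPositions χ V).image (fun i => ({i, f i} : Finset (Fin n))) ∧ j ∈ W := by
        intro i hi j hj
        refine ⟨{i, f i}, ⟨Finset.mem_image_of_mem _ hi, hj⟩, ?_⟩
        rintro W ⟨hW, hjW⟩
        obtain ⟨i', hi', rfl⟩ := Finset.mem_image.1 hW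
        suffices i' = i by rw [this]
        simp only [Finset.mem_insert, Finset.mem_singleton] at hj hjW
        rcases hj with rfl | rfl <;> rcases hjW with h | h
        · exact h.symm
        · exact absurd h (hne (hl _ hi).2 (hfr _ hi').2)
        · exact absurd h.symm (hne (hl _ hi').2 (hfr _ hi).2)
        · exact hf.injOn hi' hi h.symm
      intro j hj
      cases hs : χ j with
      | l => exact main j (mem_leftPositions.2 ⟨hj, hs⟩) j (by simp)
      | r =>
        have : j ∈ (leftPositions χ V).image f := himg ▸ mem_rightPositions.2 ⟨hj, hs⟩
        obtain ⟨i, hi, rfl⟩ := Finset.mem_image.1 this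
        exact main i hi (f i) (by simp))
    (by
      intro h0
      obtain ⟨i, -, hi⟩ := Finset.mem_image.1 h0
      exact Finset.insert_ne_empty _ _ hi)
  refine ⟨π, ?_, ?_⟩
  · intro P hP Q hQ a ha b hb c hc d hd hab hbc hcd
    obtain ⟨i, hi, rfl⟩ := Finset.mem_image.1 hP
    obtain ⟨j, hj, rfl⟩ := Finset.mem_image.1 hQ
    exfalso
    have hil := (hl i hi).2
    have hjl := (hl j hj).2
    have hir := (hfr i hi).2
    have hjr := (hfr j hj).2
    have hij := @hf i hi j hj
    -- Along `≺_χ` no left position follows a right one, which leaves few cases. The essential one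
    -- is `i ≺ j ≺ f i ≺ f j`, that is `i < j` and `f j < f i`, excluded by monotonicity; the others
    -- contain a cycle of inequalities.
    simp only [Finset.mem_insert, Finset.mem_singleton] at ha hb hc hd
    rcases ha with rfl | rfl <;> rcases hb with rfl | rfl <;> rcases hc with rfl | rfl <;>
      rcases hd with rfl | rfl <;> simp only [chiLT, hil, hjl, hir, hjr] at hab hbc hcd <;>
      first | exact lt_asymm hab hbc | exact lt_asymm hbc hcd | exact lt_asymm hcd (hij hab)
  · intro W hW
    obtain ⟨i, hi, rfl⟩ := Finset.mem_image.1 hW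
    exact ⟨i, f i, rfl, (hl i hi).2, (hfr i hi).2, by simp [hω i hi]⟩

theorem IsOppositePair.hasOppositeWords {V : Finset (Fin n)} (h : IsOppositePair χ ω V) :
    HasOppositeWords χ ω V := by
  obtain ⟨i, j, rfl, hi, hj, hij⟩ := h
  have h1 : leftPositions χ {i, j} = {i} := by
    ext k; simp only [mem_leftPositions, Finset.mem_insert, Finset.mem_singleton]; grind
  have h2 : rightPositions χ {i, j} = {j} := by
    ext k; simp only [mem_rightPositions, Finset.mem_insert, Finset.mem_singleton]; grind
  simp only [HasOppositeWords, h1, h2, Finset.sort_singleton, List.map_cons, List.map_nil]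
  revert hij
  cases ω i <;> cases ω j <;> simp

theorem IsOppositePair.card_eq_two {V : Finset (Fin n)} (h : IsOppositePair χ ω V) :
    V.card = 2 := by
  obtain ⟨i, j, rfl, hi, hj, -⟩ := h
  exact Finset.card_pair (by rintro rfl; rw [hi] at hj; cases hj)

theorem IsOppositePairing.eq_of_isOppositePair {V W : Finset (Fin n)} {π : Finpartition V}
    (hπ : IsOppositePairing χ ω π) (hV : IsOppositePair χ ω V) (hW : W ∈ π.parts) : W = V :=
  Finset.eq_of_subset_of_card_le (π.subset hW)
    (by rw [hV.card_eq_two, (hπ.isOppositePair W hW).card_eq_two])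

-- Each product is the indicator of an opposite pairing, and there is one such pairing or none. The
-- subtracted term accounts for the excluded one-block partition, which is an opposite pairing
-- exactly when `V` is an opposite pair. For empty `V` the partition without blocks is counted.
open Classical in
theorem sum_prod_isOppositePair (V : Finset (Fin n)) :
    ∑ π : {π : Finpartition V // IsBiNonCrossing χ π ∧ V ∉ π.parts},
      ∏ W : {W : Finset (Fin n) // W ∈ π.1.parts}, (if IsOppositePair χ ω W.1 then (1 : ℂ) else 0) =
    (if HasOppositeWords χ ω V then 1 else 0) - (if IsOppositePair χ ω V then 1 else 0) := by
  have hprod : ∀ π : {π : Finpartition V // IsBiNonCrossing χ π ∧ V ∉ π.parts},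
      ∏ W : {W : Finset (Fin n) // W ∈ π.1.parts},
        (if IsOppositePair χ ω W.1 then (1 : ℂ) else 0) =
      if IsOppositePairing χ ω π.1 then 1 else 0 := by
    intro π
    by_cases h : IsOppositePairing χ ω π.1
    · rw [if_pos h]
      exact Finset.prod_eq_one fun W _ => if_pos (h.isOppositePair W.1 W.2)
    · rw [if_neg h]
      have : ∃ W ∈ π.1.parts, ¬ IsOppositePair χ ω W := by
        by_contra! hW
        exact h ⟨π.2.1, hW⟩
      obtain ⟨W, hW, hWn⟩ := this
      exact Finset.prod_eq_zero (Finset.mem_univ ⟨W, hW⟩) (if_neg hWn)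
  simp only [hprod]
  by_cases hV : IsOppositePair χ ω V
  · rw [if_pos hV, if_pos hV.hasOppositeWords, sub_self]
    refine Finset.sum_eq_zero fun π _ => if_neg fun hπ => ?_
    -- A pairing of a two-element set has that set as a block, which the range of summation forbids.
    obtain ⟨W, hW⟩ := π.1.parts_nonempty (by
      rintro rfl
      simpa using hV.card_eq_two)
    exact π.2.2 (hπ.eq_of_isOppositePair hV hW ▸ hW)
  · rw [if_neg hV, sub_zero]
    by_cases hm : HasOppositeWords χ ω V
    · rw [if_pos hm]
      obtain ⟨π, hπ⟩ := hm.exists_isOppositePairing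
      rw [Finset.sum_eq_single ⟨π, hπ.isBiNonCrossing, fun h => hV (hπ.isOppositePair V h)⟩,
        if_pos hπ]
      · exact fun π' _ hne => if_neg fun h => hne (Subtype.ext (h.unique hπ))
      · exact fun h => absurd (Finset.mem_univ _) h
    · rw [if_neg hm]
      exact Finset.sum_eq_zero fun π _ => if_neg fun hπ => hm hπ.hasOppositeWords

end Pairings

/-! ### The cumulants of the model -/

namespace BiWord

open MonoidAlgebra

/-- Left and right letters commute, so only the order within each side survives. The Boolean `p` is
a decidable form of being a left position. -/
theorem prod_map_letter {n : ℕ} (χ : Fin n → Side) (ω : Fin n → Bool) (p : Fin n → Bool)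
    (hp : ∀ i, p i = true ↔ χ i = Side.l) (L : List (Fin n)) :
    (L.map (fun k => letter (χ k) (ω k))).prod =
      mk ((L.filter p).map ω) ((L.filter (fun i => !p i)).map ω) := by
  induction L with
  | nil => ext1 <;> simp
  | cons k L ih =>
    have hk := hp k
    rw [List.map_cons, List.prod_cons, ih]
    cases hs : χ k
    · have hk : p k = true := hk.2 hs
      ext1 <;> simp [letter, hk]
    · have hk : p k = false := by simpa [hs] using hk
      ext1 <;> simp [letter, hk]

theorem filter_sort {n : ℕ} (V U : Finset (Fin n)) (p : Fin n → Bool)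
    (h : ∀ i, i ∈ U ↔ i ∈ V ∧ p i = true) : V.sort.filter p = U.sort := by
  refine List.SortedLT.eq_of_mem_iff ?_ U.sortedLT_sort (by simp [h])
  exact (V.sortedLT_sort.pairwise.filter p).sortedLT

open Classical in
theorem state_orderedProd {n : ℕ} (χ : Fin n → Side) (ω : Fin n → Bool) (V : Finset (Fin n)) :
    state (orderedProd (fun k => single (letter (χ k) (ω k)) (1 : ℂ)) V) =
      if HasOppositeWords χ ω V then 1 else 0 := by
  have h1 : orderedProd (fun k => single (letter (χ k) (ω k)) (1 : ℂ)) V =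
      single (V.sort.map (fun k => letter (χ k) (ω k))).prod 1 := by
    rw [orderedProd]
    induction V.sort with
    | nil => rfl
    | cons k L ih => simp [ih, single_mul_single]
  have hp : ∀ i, decide (χ i = Side.l) = true ↔ χ i = Side.l := fun i => decide_eq_true_iff
  rw [h1, prod_map_letter χ ω _ hp, state_single,
    filter_sort V (leftPositions χ V) _ (by simp [mem_leftPositions]),
    filter_sort V (rightPositions χ V) _ (fun i => by
      rw [mem_rightPositions]; cases χ i <;> simp)]
  -- The matching condition for these two words is `HasOppositeWords` by definition.
  rfl

-- Strong induction on the cardinality of `V`, bounded by `N`: the candidate values solve the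
-- recursion that defines the cumulants.
open Classical in
theorem biFreeCumulantOn_letter {n : ℕ} (χ : Fin n → Side) (ω : Fin n → Bool) (N : ℕ) :
    ∀ V : Finset (Fin n), V.card < N →
    biFreeCumulantOn state χ (fun k => single (letter (χ k) (ω k)) (1 : ℂ)) V =
      if IsOppositePair χ ω V then 1 else 0 := by
  induction N with
  | zero => intro V hV; omega
  | succ N ih =>
    intro V hV
    -- Rearranged, the claim says that the moment minus the candidate value is the sum over the
    -- other partitions. Their blocks are proper subsets of `V`, so the induction hypothesis
    -- applies.
    rw [biFreeCumulantOn, state_orderedProd, sub_eq_iff_eq_add', ← sub_eq_iff_eq_add,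
      ← sum_prod_isOppositePair]
    refine Finset.sum_congr rfl fun π _ => Finset.prod_congr rfl fun W _ => (ih W.1 ?_).symm
    have := Finset.card_lt_card (lt_of_le_of_ne (π.1.le W.2)
      (fun h => π.2.2 (Eq.mp (congrArg (· ∈ π.1.parts) h) W.2)))
    omega

open Classical in
theorem biFreeCumulant_letter {n : ℕ} (χ : Fin n → Side) (ω : Fin n → Bool) :
    biFreeCumulant state χ (fun k => starLetter (single (letter Side.l false) (1 : ℂ))
      (single (letter Side.r false) 1) (χ k) (ω k)) =
      if IsOppositePair χ ω Finset.univ then 1 else 0 := by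
  simp only [starLetter_single]
  exact biFreeCumulantOn_letter χ ω _ _ (Nat.lt_succ_self _)

theorem biFreeCumulant_pair {s t : Side} {e e' : Bool} (hst : s ≠ t) (he : e ≠ e') :
    biFreeCumulant state ![s, t] ![starLetter (single (letter Side.l false) (1 : ℂ))
      (single (letter Side.r false) 1) s e, starLetter (single (letter Side.l false) (1 : ℂ))
      (single (letter Side.r false) 1) t e'] = 1 := by
  have h := biFreeCumulant_letter ![s, t] ![e, e']
  rw [if_pos] at h
  · refine Eq.trans (congrArg _ (funext fun k => ?_)) h
    fin_cases k <;> rfl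
  · cases s <;> cases t
    · exact absurd rfl hst
    · exact ⟨0, 1, by decide, rfl, rfl, he⟩
    · exact ⟨1, 0, by decide, rfl, rfl, he.symm⟩
    · exact absurd rfl hst

theorem eq_two_of_isOppositePair_univ {n : ℕ} {χ : Fin n → Side} {ω : Fin n → Bool}
    (h : IsOppositePair χ ω Finset.univ) :
    n = 2 ∧ ∀ i j, i ≠ j → χ i ≠ χ j ∧ ω i ≠ ω j := by
  refine ⟨by simpa using h.card_eq_two, fun i j hij => ?_⟩
  obtain ⟨a, b, hab, ha, hb, hω⟩ := h
  have hmem : ∀ k, k = a ∨ k = b := fun k => by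
    simpa [hab] using Finset.mem_univ k
  rcases hmem i with rfl | rfl <;> rcases hmem j with rfl | rfl <;>
    first | exact absurd rfl hij | simp [ha, hb, hω, hω.symm]

theorem biFreeCumulant_eq_zero {n : ℕ} {χ : Fin n → Side} {ω : Fin n → Bool}
    (h : ¬ (n = 2 ∧ ∀ i j, i ≠ j → χ i ≠ χ j ∧ ω i ≠ ω j)) :
    biFreeCumulant state χ (fun k => starLetter (single (letter Side.l false) (1 : ℂ))
      (single (letter Side.r false) 1) (χ k) (ω k)) = 0 := by
  classical
  rw [biFreeCumulant_letter, if_neg fun h' => h (eq_two_of_isOppositePair_univ h')]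

theorem isRDiagonal_state :
    IsRDiagonal state (single (letter Side.l false) (1 : ℂ)) (single (letter Side.r false) 1) := by
  intro n χ ω h
  refine biFreeCumulant_eq_zero fun ⟨hn, h2⟩ => h ⟨hn ▸ even_two, fun i j hij _ => ?_⟩
  refine (h2 i j ?_).2
  -- `≺_χ` is irreflexive, so consecutive positions are distinct.
  rintro rfl
  revert hij
  cases hs : χ i <;> simp [chiLT, hs]

/-- In `xx* y*y` the left word is un-starred, starred and the right word starred, un-starred:
matched, with moment 1. In each factor alone one word is empty and the other is not, so both moments
vanish, and factorization would give `1 = 0`. -/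
theorem not_areBiFreePairs_state {x y : MonoidAlgebra ℂ BiWord}
    (hx : x = single (letter Side.l false) 1) (hy : y = single (letter Side.r false) 1) :
    ¬ AreBiFreePairs state (x * star x, y * star y) (star x * x, star y * y) := by
  intro h
  have := h.map_mul
  simp [hx, hy, star_single, star_def, letter, single_mul_single, state_single, IsMatched] at this

end BiWord

theorem theorem2p7 :
    ∃ (A : Type) (_ : Ring A) (_ : StarRing A) (_ : Algebra ℂ A) (_ : StarModule ℂ A)
      (φ : A →ₗ[ℂ] ℂ) (x y : A),
      IsStarProbability φ ∧
      IsRDiagonal φ x y ∧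
      ¬ AreBiFreePairs φ (x * star x, y * star y) (star x * x, star y * y) ∧
      biFreeCumulant φ ![Side.l, Side.r] ![x, star y] = 1 ∧
      biFreeCumulant φ ![Side.l, Side.r] ![star x, y] = 1 ∧
      biFreeCumulant φ ![Side.r, Side.l] ![y, star x] = 1 ∧
      biFreeCumulant φ ![Side.r, Side.l] ![star y, x] = 1 ∧
      ∀ (n : ℕ) (χ : Fin n → Side) (ω : Fin n → Bool), 0 < n →
        ¬ (n = 2 ∧ ∀ i j, i ≠ j → χ i ≠ χ j ∧ ω i ≠ ω j) →
        biFreeCumulant φ χ (fun k => starLetter x y (χ k) (ω k)) = 0 :=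
  ⟨MonoidAlgebra ℂ BiWord, inferInstance, inferInstance, inferInstance, inferInstance,
    BiWord.state, MonoidAlgebra.single (BiWord.letter Side.l false) 1,
    MonoidAlgebra.single (BiWord.letter Side.r false) 1,
    BiWord.isStarProbability_state, BiWord.isRDiagonal_state,
    BiWord.not_areBiFreePairs_state rfl rfl,
    BiWord.biFreeCumulant_pair (s := Side.l) (t := Side.r) (e := false) (e' := true)
      Side.noConfusion Bool.noConfusion,
    BiWord.biFreeCumulant_pair (s := Side.l) (t := Side.r) (e := true) (e' := false)
      Side.noConfusion Bool.noConfusion,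
    BiWord.biFreeCumulant_pair (s := Side.r) (t := Side.l) (e := false) (e' := true)
      Side.noConfusion Bool.noConfusion,
    BiWord.biFreeCumulant_pair (s := Side.r) (t := Side.l) (e := true) (e' := false)
      Side.noConfusion Bool.noConfusion,
    fun _ _ _ _ h => BiWord.biFreeCumulant_eq_zero h⟩
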